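/- Let $G$ be a finitely generated solvable group that is torsion-free (its only element of finite order is the identity) and not virtually abelian (it has no abelian subgroup of finite index). Let $X$ be a set with a faithful action of $G$ that has only finitely many orbits. Let $S$ be a finite generating set of $G$, and let $\Gamma(G,X)$ be the Schreier graph of the action, i.e. the unoriented graph with vertex set $X$ and an edge between $x$ and $sx$ for all $x\in X$, $s\in S$, endowed with its graph distance (equal to $+\infty$ between different components). Let $$\mathrm{vol}_{G,X}(n)=\max_{x\in X}|B_x(n)|$$ be the maximal cardinality of a ball of radius $n$ in $\Gamma(G,X)$. Then $\mathrm{vol}_{G,X}(n)\succcurlyeq n^2$, that is, there is an integer $C>0$ such that $n^2\le C\,\mathrm{vol}_{G,X}(Cn)$ for all sufficiently large $n$. -/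

import Mathlib

/-- A group is torsion-free if its only element of finite order is the identity. (Mathlib's
`IsMulTorsionFree` is the stronger condition that roots are unique.) -/
def GroupTorsionFree (G : Type*) [Group G] : Prop :=
  ∀ g : G, IsOfFinOrder g → g = 1

/-- A group is virtually abelian if it has an abelian subgroup of finite index. -/
def IsVirtuallyAbelian (G : Type*) [Group G] : Prop :=
  ∃ H : Subgroup G, IsMulCommutative H ∧ H.FiniteIndex

/-- The Schreier graph of the action of `G` on `X` with respect to `S`: the vertex set is `X`, and
`x` is joined to `s • x` for all `x : X` and `s ∈ S`. Edges are unoriented; loops and multiple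
edges are dropped, which does not affect distances. -/
def schreierGraph {G : Type*} [Group G] (S : Set G) (X : Type*) [MulAction G X] :
    SimpleGraph X :=
  SimpleGraph.fromRel fun x y => ∃ s ∈ S, s • x = y

/-- The ball of radius `n` around `x` in the Schreier graph, for the graph distance with values in
`ℕ∞` (infinite between distinct components). -/
def schreierBall {G : Type*} [Group G] (S : Set G) {X : Type*} [MulAction G X]
    (x : X) (n : ℕ) : Set X :=
  {y | (schreierGraph S X).edist x y ≤ n}

/-- The growth of the action of `G` on `X`: the maximal cardinality of a ball of radius `n` in the
Schreier graph. For finite `S` the maximum is attained, see `isGreatest_actionGrowth`. -/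
noncomputable def actionGrowth {G : Type*} [Group G] (S : Set G) (X : Type*) [MulAction G X]
    (n : ℕ) : ℕ :=
  ⨆ x : X, (schreierBall S x n).ncard

/-- `f ≼ g`: there is a constant `C > 0` with `f n ≤ C * g (C * n)` for all large `n`. -/
def GrowthLE (f g : ℕ → ℕ) : Prop :=
  ∃ C : ℕ, 0 < C ∧ ∀ᶠ n in Filter.atTop, f n ≤ C * g (C * n)

theorem schreierBall_succ_subset {G : Type*} [Group G] (S : Set G) {X : Type*} [MulAction G X]
    (x : X) (n : ℕ) :
    schreierBall S x (n + 1) ⊆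
      ⋃ t ∈ insert 1 (S ∪ S⁻¹), (fun y => t • y) '' schreierBall S x n := by
  intro y hy
  simp only [Set.mem_iUnion, exists_prop]
  by_cases hn : y ∈ schreierBall S x n
  · exact ⟨1, Set.mem_insert _ _, y, hn, one_smul _ _⟩
  have hy' : (schreierGraph S X).edist y x ≤ (n + 1 : ℕ) := by
    rw [SimpleGraph.edist_comm]; exact hy
  have hne : (schreierGraph S X).edist y x ≠ ⊤ :=
    ne_top_of_le_ne_top (ENat.natCast_ne_top _) hy'
  obtain ⟨p, hp⟩ := (SimpleGraph.edist_ne_top_iff_reachable.1 hne).exists_walk_length_eq_edist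
  cases p with
  | nil => exact absurd (by simp [schreierBall]) hn
  | @cons _ z _ h q =>
    have hq : z ∈ schreierBall S x n := by
      have h1 : q.length + 1 ≤ n + 1 := by
        rw [← hp, SimpleGraph.Walk.length_cons] at hy'
        exact_mod_cast hy'
      have h2 : (schreierGraph S X).edist z x ≤ q.length := SimpleGraph.edist_le q
      rw [SimpleGraph.edist_comm] at h2
      exact h2.trans (by exact_mod_cast (by omega : q.length ≤ n))
    rw [schreierGraph, SimpleGraph.fromRel_adj] at h
    obtain ⟨-, ⟨s, hs, rfl⟩ | ⟨s, hs, rfl⟩⟩ := h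
    · exact ⟨s⁻¹, Or.inr (Or.inr (by simpa using hs)), _, hq, inv_smul_smul _ _⟩
    · exact ⟨s, Or.inr (Or.inl hs), _, hq, rfl⟩

theorem schreierBall_finite_and_ncard_le {G : Type*} [Group G] {S : Set G} (hS : S.Finite)
    {X : Type*} [MulAction G X] (x : X) (n : ℕ) :
    (schreierBall S x n).Finite ∧
      (schreierBall S x n).ncard ≤ (insert 1 (S ∪ S⁻¹)).ncard ^ n := by
  have hT : (insert 1 (S ∪ S⁻¹)).Finite := (hS.union hS.inv).insert 1
  induction n with
  | zero =>
    have h : schreierBall S x 0 = {x} := by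
      ext y
      simp [schreierBall, SimpleGraph.edist_eq_zero_iff, eq_comm (a := x)]
    simp [h]
  | succ n ih =>
    obtain ⟨hf, hc⟩ := ih
    have hsub := schreierBall_succ_subset S x n
    have hfin : (⋃ t ∈ insert 1 (S ∪ S⁻¹), (fun y => t • y) '' schreierBall S x n).Finite :=
      hT.biUnion fun t _ => hf.image _
    refine ⟨hfin.subset hsub, (Set.ncard_le_ncard hsub hfin).trans ?_⟩
    have hprod : (⋃ t ∈ insert 1 (S ∪ S⁻¹), (fun y => t • y) '' schreierBall S x n) =
        (fun p : G × X => p.1 • p.2) '' ((insert 1 (S ∪ S⁻¹)) ×ˢ schreierBall S x n) := by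
      ext y
      simp only [Set.mem_iUnion, Set.mem_image, Set.mem_prod, Prod.exists, exists_prop]
      constructor
      · rintro ⟨t, ht, z, hz, rfl⟩
        exact ⟨t, z, ⟨ht, hz⟩, rfl⟩
      · rintro ⟨t, z, ⟨ht, hz⟩, rfl⟩
        exact ⟨t, ht, z, hz, rfl⟩
    rw [hprod, pow_succ']
    refine (Set.ncard_image_le (hT.prod hf)).trans ?_
    rw [Set.ncard_prod]
    exact Nat.mul_le_mul_left _ hc

/-- For a finite set `S` and a nonempty `X`, the supremum in `actionGrowth` is a maximum. -/
theorem isGreatest_actionGrowth {G : Type*} [Group G] {S : Set G} (hS : S.Finite)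
    (X : Type*) [MulAction G X] [Nonempty X] (n : ℕ) :
    IsGreatest (Set.range fun x : X => (schreierBall S x n).ncard) (actionGrowth S X n) := by
  have hb : BddAbove (Set.range fun x : X => (schreierBall S x n).ncard) := by
    refine ⟨(insert 1 (S ∪ S⁻¹)).ncard ^ n, ?_⟩
    rintro _ ⟨x, rfl⟩
    exact (schreierBall_finite_and_ncard_le hS x n).2
  exact ⟨Nat.sSup_mem (Set.range_nonempty _) hb, fun m hm => le_csSup hb hm⟩

/-! Suppose the growth is not at least quadratic. By `growthLE_sq_of_forall_injOn`, no `n × n` grid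
of elements of displacement `O(n)` can then be injective on a point for every `n`. A nontrivial
commutator `z = [g, h]` commuting with `g` and `h` has infinite order and quadratic distortion,
which yields such grids. So there is none, and solvability gives a normal abelian `A` containing its
centralizer (`exists_normal_centralizer_le`).

It remains to see that the centralizer of `A` has finite index
(`finiteIndex_centralizer_of_not_growthLE_sq`), for then so has `A`. On a `G`-orbit made of
infinitely many `A`-orbits, combining `n` of these with `n` powers of `a` shows that a power of `a ∈
A` acts trivially. Elsewhere a finite index subgroup `G₀` preserves each `A`-orbit. Such an orbit
has rank at most one, so `g ∈ G₀` scales `a` by a rational, which is `±1` because any other factor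
makes `a` or a power of it exponentially distorted. Hence `[g², a]` has finite order on each orbit,
uniformly as there are finitely many `G`-orbits; faithfulness and torsion-freeness give `[g², a] =
1`. -/

/-! ### Displacement and the counting criterion -/

/-- `g` moves every point of `X` by at most `n` in the Schreier graph. -/
def DisplacementLE {G : Type*} [Group G] (S : Set G) (X : Type*) [MulAction G X] (g : G)
    (n : ℕ) : Prop :=
  ∀ x : X, (schreierGraph S X).edist x (g • x) ≤ n

namespace DisplacementLE

variable {G : Type*} [Group G] {S : Set G} {X : Type*} [MulAction G X] {g h : G} {m n : ℕ}

theorem mono (hg : DisplacementLE S X g m) (hmn : m ≤ n) : DisplacementLE S X g n :=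
  fun x => (hg x).trans (by exact_mod_cast hmn)

theorem one : DisplacementLE S X 1 0 := fun x => by simp

theorem mul (hg : DisplacementLE S X g m) (hh : DisplacementLE S X h n) :
    DisplacementLE S X (g * h) (m + n) := fun x => by
  rw [mul_smul, Nat.cast_add, add_comm]
  exact SimpleGraph.edist_triangle.trans (add_le_add (hh x) (hg _))

theorem inv (hg : DisplacementLE S X g n) : DisplacementLE S X g⁻¹ n := fun x => by
  have h := hg (g⁻¹ • x)
  rwa [smul_inv_smul, SimpleGraph.edist_comm] at h

theorem pow (hg : DisplacementLE S X g n) (k : ℕ) : DisplacementLE S X (g ^ k) (k * n) := by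
  induction k with
  | zero => simpa using one
  | succ k ih =>
    rw [pow_succ]
    exact (ih.mul hg).mono (by ring_nf; rfl)

theorem of_mem (hg : g ∈ S) : DisplacementLE S X g 1 := fun x => by
  by_cases hx : x = g • x
  · rw [← hx]; simp
  · have hadj : (schreierGraph S X).Adj x (g • x) := by
      rw [schreierGraph, SimpleGraph.fromRel_adj]
      exact ⟨hx, Or.inl ⟨g, hg, rfl⟩⟩
    simpa using SimpleGraph.edist_le hadj.toWalk

theorem exists_of_closure_eq_top (X : Type*) [MulAction G X] (hgen : Subgroup.closure S = ⊤)
    (g : G) : ∃ n, DisplacementLE S X g n := by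
  have hg : g ∈ Subgroup.closure S := hgen ▸ Subgroup.mem_top g
  induction hg using Subgroup.closure_induction with
  | mem g hg => exact ⟨1, of_mem hg⟩
  | one => exact ⟨0, one⟩
  | mul g h _ _ hg hh => exact ⟨_, hg.choose_spec.mul hh.choose_spec⟩
  | inv g _ hg => exact ⟨_, hg.choose_spec.inv⟩

end DisplacementLE

/-- The base point may vary with `n`, because the growth is a maximum over all centres. -/
theorem growthLE_sq_of_forall_injOn {G : Type*} [Group G] {S : Set G} (hfin : S.Finite)
    {X : Type*} [MulAction G X] (C : ℕ)
    (h : ∀ n : ℕ, ∃ x : X, ∃ f : ℕ → ℕ → G,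
      (∀ i < n, ∀ j < n, DisplacementLE S X (f i j) (C * n)) ∧
      ∀ i < n, ∀ j < n, ∀ i' < n, ∀ j' < n, f i j • x = f i' j' • x → i = i' ∧ j = j') :
    GrowthLE (fun n => n ^ 2) (actionGrowth S X) := by
  refine ⟨C + 1, Nat.succ_pos _, Filter.Eventually.of_forall fun n => ?_⟩
  obtain ⟨x, f, hf, hinj⟩ := h n
  have hle : n ^ 2 ≤ (schreierBall S x ((C + 1) * n)).ncard := by
    classical
    have hcard : ((Finset.range n ×ˢ Finset.range n).image
        fun p : ℕ × ℕ => f p.1 p.2 • x).card = n ^ 2 := by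
      rw [Finset.card_image_of_injOn, Finset.card_product, Finset.card_range, sq]
      rintro ⟨i, j⟩ hij ⟨i', j'⟩ hij' heq
      simp only [Finset.coe_product, Finset.coe_range, Set.mem_prod, Set.mem_Iio] at hij hij'
      simpa using hinj i hij.1 j hij.2 i' hij'.1 j' hij'.2 heq
    rw [← hcard, ← Set.ncard_coe_finset]
    refine Set.ncard_le_ncard ?_ (schreierBall_finite_and_ncard_le hfin x _).1
    intro y hy
    simp only [Finset.coe_image, Finset.coe_product, Finset.coe_range, Set.mem_image,
      Set.mem_prod, Set.mem_Iio] at hy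
    obtain ⟨⟨i, j⟩, ⟨hi, hj⟩, rfl⟩ := hy
    exact ((hf i hi j hj).mono (Nat.mul_le_mul_right n (Nat.le_succ C))) x
  have : Nonempty X := ⟨x⟩
  exact (hle.trans ((isGreatest_actionGrowth hfin X _).2 ⟨x, rfl⟩)).trans
    (Nat.le_mul_of_pos_left _ (Nat.succ_pos _))

/-- Every difference of exponents below `n` divides `n!`, so a single power rules out all short
periods. -/
theorem eq_of_pow_smul_eq_pow_smul {G : Type*} [Group G] {X : Type*} [MulAction G X] {a : G}
    {x : X} {n : ℕ} (hx : a ^ n.factorial • x ≠ x) {i j : ℕ} (hi : i < n) (hj : j < n)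
    (hij : a ^ i • x = a ^ j • x) : i = j := by
  wlog hlt : i < j generalizing i j
  · rcases (not_lt.1 hlt).eq_or_lt with h | h
    · exact h.symm
    · exact (this hj hi hij.symm h).symm
  refine absurd ?_ hx
  obtain ⟨c, hc⟩ : j - i ∣ n.factorial := Nat.dvd_factorial (by omega) (by omega)
  have hfix : a ^ (j - i) ∈ MulAction.stabilizer G x := by
    rw [MulAction.mem_stabilizer_iff]
    apply MulAction.injective (a ^ i)
    change a ^ i • a ^ (j - i) • x = a ^ i • x
    rw [← mul_smul, ← pow_add, Nat.add_sub_cancel' hlt.le, hij]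
  rw [hc, pow_mul]
  exact MulAction.mem_stabilizer_iff.1 (Subgroup.pow_mem _ hfix c)

theorem GroupTorsionFree.eq_one_of_pow_eq_one {G : Type*} [Group G] (htf : GroupTorsionFree G)
    {g : G} {n : ℕ} (hn : 0 < n) (h : g ^ n = 1) : g = 1 :=
  htf g (isOfFinOrder_iff_pow_eq_one.2 ⟨n, hn, h⟩)

/-! ### Central commutators -/

theorem pow_mul_pow_eq_of_commutator_commute {G : Type*} [Group G] {g h z : G}
    (hz : g * h = z * (h * g)) (hzg : Commute z g) (hzh : Commute z h) (i j : ℕ) :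
    g ^ i * h ^ j = z ^ (i * j) * (h ^ j * g ^ i) := by
  have h1 : ∀ j : ℕ, g * h ^ j = z ^ j * (h ^ j * g) := by
    intro j
    induction j with
    | zero => simp
    | succ j ih =>
      calc g * h ^ (j + 1) = (g * h ^ j) * h := by rw [pow_succ, mul_assoc]
        _ = z ^ j * h ^ j * (g * h) := by rw [ih]; group
        _ = z ^ j * (h ^ j * z) * (h * g) := by rw [hz]; group
        _ = z ^ j * (z * h ^ j) * (h * g) := by rw [(hzh.pow_right j).eq]
        _ = z ^ (j + 1) * (h ^ (j + 1) * g) := by rw [pow_succ, pow_succ]; group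
  induction i with
  | zero => simp
  | succ i ih =>
    calc g ^ (i + 1) * h ^ j = g ^ i * (g * h ^ j) := by rw [pow_succ, mul_assoc]
      _ = (g ^ i * z ^ j) * (h ^ j * g) := by rw [h1]; group
      _ = (z ^ j * g ^ i) * (h ^ j * g) := by rw [((hzg.pow_left j).pow_right i).eq]
      _ = z ^ j * (g ^ i * h ^ j) * g := by group
      _ = z ^ j * (z ^ (i * j) * (h ^ j * g ^ i)) * g := by rw [ih]
      _ = z ^ (j + i * j) * (h ^ j * (g ^ i * g)) := by rw [pow_add]; group
      _ = z ^ ((i + 1) * j) * (h ^ j * g ^ (i + 1)) := by rw [pow_succ]; congr 2; ring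

/-- A nontrivial central commutator is quadratically distorted. -/
theorem growthLE_sq_of_commutator_commute {G : Type*} [Group G] (htf : GroupTorsionFree G)
    {S : Set G} (hfin : S.Finite) (hgen : Subgroup.closure S = ⊤) {X : Type*} [MulAction G X]
    [FaithfulSMul G X] {g h z : G} (hz : g * h = z * (h * g)) (hzg : Commute z g)
    (hzh : Commute z h) (hz1 : z ≠ 1) : GrowthLE (fun n => n ^ 2) (actionGrowth S X) := by
  obtain ⟨lg, hlg⟩ := DisplacementLE.exists_of_closure_eq_top X hgen g
  obtain ⟨lh, hlh⟩ := DisplacementLE.exists_of_closure_eq_top X hgen h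
  obtain ⟨lz, hlz⟩ := DisplacementLE.exists_of_closure_eq_top X hgen z
  refine growthLE_sq_of_forall_injOn hfin (2 * lg + 2 * lh + lz) fun n => ?_
  have hne : z ^ (n ^ 2).factorial ≠ 1 := fun hc =>
    hz1 (htf.eq_one_of_pow_eq_one (Nat.factorial_pos _) hc)
  obtain ⟨x, hx⟩ : ∃ x : X, z ^ (n ^ 2).factorial • x ≠ x := by
    by_contra! hc
    exact hne (FaithfulSMul.eq_of_smul_eq_smul fun x : X => by rw [hc, one_smul])
  -- The commutator of `g ^ i` and `h ^ n` is `z ^ (i * n)`, so these are the `z ^ (i * n + j)`: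
  -- exponents written in base `n`, at displacement only `O(n)`.
  refine ⟨x, fun i j => g ^ i * h ^ n * ((h ^ n * g ^ i)⁻¹ * z ^ j), fun i hi j hj => ?_, ?_⟩
  · refine (((hlg.pow i).mul (hlh.pow n)).mul
      (((hlh.pow n).mul (hlg.pow i)).inv.mul (hlz.pow j))).mono ?_
    nlinarith [Nat.mul_le_mul_right lg hi.le, Nat.mul_le_mul_right lz hj.le]
  · have key : ∀ i j : ℕ, g ^ i * h ^ n * ((h ^ n * g ^ i)⁻¹ * z ^ j) = z ^ (i * n + j) := by
      intro i j
      rw [pow_mul_pow_eq_of_commutator_commute hz hzg hzh, pow_add]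
      group
    have hlt : ∀ i < n, ∀ j < n, i * n + j < n ^ 2 := fun i hi j hj => by nlinarith
    intro i hi j hj i' hi' j' hj' heq
    simp only [key] at heq
    have h1 := eq_of_pow_smul_eq_pow_smul hx (hlt i hi j hj) (hlt i' hi' j' hj') heq
    have hii : i = i' := by
      have e1 : (i * n + j) / n = i := by
        rw [mul_comm, Nat.mul_add_div (by omega), Nat.div_eq_of_lt hj, add_zero]
      have e2 : (i' * n + j') / n = i' := by
        rw [mul_comm, Nat.mul_add_div (by omega), Nat.div_eq_of_lt hj', add_zero]
      rw [← e1, h1, e2]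
    subst hii
    exact ⟨rfl, by omega⟩

/-! ### Orbits with infinitely many `A`-orbits -/

/-- In an infinite coset space there are `n + 1` distinct cosets with representatives of
displacement at most `n`. -/
theorem exists_coset_reps_displacementLE {G : Type*} [Group G] {S : Set G}
    (hgen : Subgroup.closure S = ⊤) (X : Type*) [MulAction G X] {K : Subgroup G}
    (hK : ¬ K.FiniteIndex) (n : ℕ) :
    ∃ g : ℕ → G, (∀ i ≤ n, DisplacementLE S X (g i) n) ∧
      ∀ i ≤ n, ∀ j ≤ n, (g i : G ⧸ K) = g j → i = j := by
  induction n with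
  | zero => exact ⟨fun _ => 1, fun i _ => DisplacementLE.one, fun i hi j hj _ => by omega⟩
  | succ n ih =>
    obtain ⟨g, hg, hinj⟩ := ih
    let Q : Set (G ⧸ K) := (fun i => (g i : G ⧸ K)) '' Set.Iic n
    obtain ⟨t, ht, i, hi, hti⟩ : ∃ t, DisplacementLE S X t 1 ∧
        ∃ i ≤ n, ((t * g i : G) : G ⧸ K) ∉ Q := by
      -- Otherwise `Q` is stable under `S` and its inverses, hence under `G`; by transitivity it is
      -- the whole coset space, which is then finite.
      by_contra! hc
      have hinv : ∀ s : G, ∀ q ∈ Q, s • q ∈ Q ∧ s⁻¹ • q ∈ Q := by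
        intro s
        have hs : s ∈ Subgroup.closure S := hgen ▸ Subgroup.mem_top s
        induction hs using Subgroup.closure_induction with
        | mem s hs =>
          rintro _ ⟨i, hi, rfl⟩
          exact ⟨hc s (.of_mem hs) i hi, hc s⁻¹ (DisplacementLE.of_mem hs).inv i hi⟩
        | one => intro q hq; simpa using hq
        | mul s t _ _ hs ht =>
          intro q hq
          rw [mul_inv_rev, mul_smul, mul_smul]
          exact ⟨(hs _ (ht q hq).1).1, (ht _ (hs q hq).2).2⟩
        | inv s _ hs => intro q hq; rw [inv_inv]; exact (hs q hq).symm
      have huniv : Q = Set.univ := by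
        refine Set.eq_univ_of_forall fun q => ?_
        induction q using QuotientGroup.induction_on with
        | H u =>
          have := (hinv (u * (g 0)⁻¹) (g 0 : G ⧸ K) ⟨0, Nat.zero_le n, rfl⟩).1
          rwa [MulAction.Quotient.smul_coe, smul_eq_mul, inv_mul_cancel_right] at this
      have hQ : Q.Finite := (Set.finite_Iic n).image _
      rw [huniv, Set.finite_univ_iff] at hQ
      exact hK (Subgroup.finiteIndex_of_finite_quotient)
    have hne : ∀ j ≤ n, (g j : G ⧸ K) ≠ ((t * g i : G) : G ⧸ K) := fun j hj h =>
      hti ⟨j, hj, h⟩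
    refine ⟨Function.update g (n + 1) (t * g i), fun j hj => ?_, fun j hj k hk h => ?_⟩
    · rcases hj.eq_or_lt with rfl | hj
      · rw [Function.update_self, add_comm]
        exact ht.mul (hg i hi)
      · rw [Function.update_of_ne hj.ne]
        exact (hg j (by omega)).mono (Nat.le_succ n)
    · rcases hj.eq_or_lt with rfl | hj <;> rcases hk.eq_or_lt with rfl | hk
      · rfl
      · rw [Function.update_self, Function.update_of_ne hk.ne] at h
        exact absurd h.symm (hne k (by omega))
      · rw [Function.update_self, Function.update_of_ne hj.ne] at h
        exact absurd h (hne j (by omega))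
      · rw [Function.update_of_ne hj.ne, Function.update_of_ne hk.ne] at h
        exact hinj j (by omega) k (by omega) h

/-- Unless the growth is at least quadratic, some power of `a ∈ A` acts trivially on the union of the
`G`-orbits that consist of infinitely many `A`-orbits. -/
theorem exists_pow_smul_eq_of_not_growthLE_sq {G : Type*} [Group G] {S : Set G}
    (hfin : S.Finite) (hgen : Subgroup.closure S = ⊤) {X : Type*} [MulAction G X]
    (hgr : ¬ GrowthLE (fun n => n ^ 2) (actionGrowth S X)) (A : Subgroup G) [A.Normal]
    {a : G} (ha : a ∈ A) :
    ∃ m : ℕ, 0 < m ∧ ∀ x : X, ¬ (MulAction.stabilizer G x ⊔ A).FiniteIndex → a ^ m • x = x := by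
  by_contra! hc
  obtain ⟨la, hla⟩ := DisplacementLE.exists_of_closure_eq_top X hgen a
  refine hgr (growthLE_sq_of_forall_injOn hfin (1 + la) fun n => ?_)
  obtain ⟨x, hxK, hx⟩ := hc n.factorial (Nat.factorial_pos n)
  obtain ⟨g, hg, hinj⟩ := exists_coset_reps_displacementLE hgen X hxK n
  refine ⟨x, fun i j => g i * a ^ j, fun i hi j hj => ?_, ?_⟩
  · refine ((hg i hi.le).mul (hla.pow j)).mono ?_
    nlinarith [Nat.mul_le_mul_right la hj.le]
  · intro i hi j hj i' hi' j' hj' heq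
    have haK : ∀ k : ℕ, a ^ k ∈ MulAction.stabilizer G x ⊔ A := fun k =>
      Subgroup.mem_sup_right (A.pow_mem ha k)
    -- The stabilizer and the powers of `a` both lie in the subgroup, so the image point determines
    -- the coset of `g i`.
    have hst : (g i * a ^ j)⁻¹ * (g i' * a ^ j') ∈ MulAction.stabilizer G x ⊔ A := by
      refine Subgroup.mem_sup_left ?_
      rw [MulAction.mem_stabilizer_iff, mul_smul, ← heq, inv_smul_smul]
    have hii : i = i' := by
      refine hinj i hi.le i' hi'.le (QuotientGroup.eq.2 ?_)
      have := mul_mem (mul_mem (haK j) hst) (inv_mem (haK j'))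
      convert this using 1
      group
    subst hii
    rw [mul_smul, mul_smul, smul_left_cancel_iff] at heq
    exact ⟨rfl, eq_of_pow_smul_eq_pow_smul hx hj hj' heq⟩

/-! ### The action on a single `A`-orbit -/

/-- Orbits of abelian subgroups have rank at most one: otherwise the points `a ^ i * b ^ j • x` form
a quadratic grid. -/
theorem exists_zpow_mul_zpow_smul_eq {G : Type*} [Group G] {S : Set G}
    (hfin : S.Finite) (hgen : Subgroup.closure S = ⊤) {X : Type*} [MulAction G X]
    (hgr : ¬ GrowthLE (fun n => n ^ 2) (actionGrowth S X)) {a b : G} (hab : Commute a b) (x : X) :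
    ∃ p q : ℤ, ¬ (p = 0 ∧ q = 0) ∧ (a ^ p * b ^ q) • x = x := by
  by_contra! hc
  obtain ⟨la, hla⟩ := DisplacementLE.exists_of_closure_eq_top X hgen a
  obtain ⟨lb, hlb⟩ := DisplacementLE.exists_of_closure_eq_top X hgen b
  refine hgr (growthLE_sq_of_forall_injOn hfin (la + lb) fun n => ?_)
  refine ⟨x, fun i j => a ^ i * b ^ j, fun i hi j hj => ?_, ?_⟩
  · refine ((hla.pow i).mul (hlb.pow j)).mono ?_
    nlinarith [Nat.mul_le_mul_right la hi.le, Nat.mul_le_mul_right lb hj.le]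
  · intro i _ j _ i' _ j' _ heq
    by_contra hne
    refine hc (i - i') (j - j') (fun h h' => hne (by omega)) ?_
    have hmul : a ^ ((i : ℤ) - i') * b ^ ((j : ℤ) - j') = (a ^ i' * b ^ j')⁻¹ * (a ^ i * b ^ j) := by
      rw [zpow_sub, zpow_sub, mul_inv_rev, zpow_natCast, zpow_natCast, zpow_natCast,
        zpow_natCast]
      have h1 : Commute ((a ^ i')⁻¹) (b ^ j) := (hab.pow_pow _ _).inv_left
      have h2 : Commute ((b ^ j')⁻¹) (a ^ i) := (hab.symm.pow_pow _ _).inv_left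
      have h3 : Commute ((b ^ j')⁻¹) ((a ^ i')⁻¹) := (hab.symm.pow_pow _ _).inv_inv
      have h4 : Commute ((b ^ j')⁻¹) (b ^ j) := ((Commute.refl b).pow_pow _ _).inv_left
      have h5 : Commute ((a ^ i')⁻¹) (a ^ i) := ((Commute.refl a).pow_pow _ _).inv_left
      rw [← h4.eq, ← h5.eq]
      simp only [mul_assoc]
      rw [← mul_assoc (a ^ i), ← h2.eq, mul_assoc, ← mul_assoc, ← h3.eq, mul_assoc]
    rw [hmul, mul_smul, heq, inv_smul_smul]

theorem Commute.zpow_smul_eq_zpow_smul {G : Type*} [Group G] {X : Type*} [MulAction G X]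
    {b c : G} (hbc : Commute b c) {x : X} (h : b • x = c • x) (k : ℤ) :
    b ^ k • x = c ^ k • x := by
  have hst : c⁻¹ * b ∈ MulAction.stabilizer G x := by
    rw [MulAction.mem_stabilizer_iff, mul_smul, h, inv_smul_smul]
  have := Subgroup.zpow_mem _ hst k
  rwa [hbc.symm.inv_left.mul_zpow, inv_zpow, MulAction.mem_stabilizer_iff, mul_smul,
    inv_smul_eq_iff] at this

section AbelianNormal

variable {G : Type*} [Group G] {X : Type*} [MulAction G X] {A : Subgroup G}

/-- `A` being abelian, its stabilizers are constant along an `A`-orbit. As `g⁻¹` keeps `x` in its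
`A`-orbit, conjugation by `g` descends to `A` modulo the stabilizer of `x`. -/
theorem conj_smul_eq_conj_smul (hA : ∀ a ∈ A, ∀ b ∈ A, Commute a b) {g d : G} {x : X}
    (hd : d ∈ A) (hgx : g⁻¹ • x = d • x) {b c : G} (hb : b ∈ A) (hc : c ∈ A)
    (h : b • x = c • x) : (g * b * g⁻¹) • x = (g * c * g⁻¹) • x := by
  rw [mul_smul, mul_smul, mul_smul, mul_smul, hgx, ← mul_smul b, ← mul_smul c,
    (hA b hb d hd).eq, (hA c hc d hd).eq, mul_smul, mul_smul, h]

variable [A.Normal]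

theorem conj_pow_zpow_smul_eq (hA : ∀ a ∈ A, ∀ b ∈ A, Commute a b) {g d : G} {x : X}
    (hd : d ∈ A) (hgx : g⁻¹ • x = d • x) {a : G} (ha : a ∈ A) {p q : ℤ}
    (h : (g * a * g⁻¹) ^ p • x = a ^ q • x) (N : ℕ) :
    (g ^ N * a * (g ^ N)⁻¹) ^ (p ^ N) • x = a ^ (q ^ N) • x := by
  have hconj : ∀ t : G, t * a * t⁻¹ ∈ A := fun t => Subgroup.Normal.conj_mem ‹_› a ha t
  induction N with
  | zero => simp
  | succ N ih =>
    have h1 := conj_smul_eq_conj_smul hA hd hgx (A.zpow_mem (hconj _) _) (A.zpow_mem ha _) ih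
    rw [← conj_zpow, ← conj_zpow] at h1
    have hstep : g * (g ^ N * a * (g ^ N)⁻¹) * g⁻¹ = g ^ (N + 1) * a * (g ^ (N + 1))⁻¹ := by
      rw [pow_succ']; group
    rw [hstep] at h1
    have h2 := (hA _ (A.zpow_mem (hconj _) _) _
      (A.zpow_mem (hconj _) _)).zpow_smul_eq_zpow_smul h1 p
    have h3 := (hA _ (A.zpow_mem (hconj g) p) _ (A.zpow_mem ha q)).zpow_smul_eq_zpow_smul h
      (q ^ N)
    rw [← zpow_mul, ← zpow_mul, ← pow_succ, mul_comm (q ^ N), zpow_mul _ p, h3, ← zpow_mul,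
      ← pow_succ'] at h2
    exact h2

theorem zpow_smul_injective {a : G} {x : X} (ha : ∀ r : ℕ, 0 < r → a ^ r • x ≠ x) :
    Function.Injective fun k : ℤ => a ^ k • x := by
  intro s t hst
  wlog hlt : s < t generalizing s t
  · rcases (not_lt.1 hlt).eq_or_lt with h | h
    · exact h.symm
    · exact (this hst.symm h).symm
  refine absurd ?_ (ha (t - s).toNat (by omega))
  rw [← zpow_natCast, Int.toNat_of_nonneg (by omega), sub_eq_neg_add, zpow_add, mul_smul]
  exact (congrArg (a ^ (-s) • ·) hst).symm.trans (by rw [← mul_smul, ← zpow_add]; simp)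

/-- By Bernoulli, `(1 + 1/|p|) ^ |p| ≥ 2`, so `|q/p| ^ (n * |p|) ≥ 2 ^ n > n`: a change in `j`
cannot be offset by a change in `i`. -/
theorem Int.eq_and_eq_of_add_mul_pow_eq {p q : ℤ} (hp : p ≠ 0) (hpq : p.natAbs < q.natAbs)
    {n i j i' j' : ℕ} (hi : i < n) (hi' : i' < n)
    (h : (i : ℤ) * p ^ (n * p.natAbs) + j * q ^ (n * p.natAbs) =
      i' * p ^ (n * p.natAbs) + j' * q ^ (n * p.natAbs)) : i = i' ∧ j = j' := by
  set N := n * p.natAbs with hN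
  have hP : 0 < p.natAbs := Int.natAbs_pos.2 hp
  have h2 : 2 * p.natAbs ^ p.natAbs ≤ q.natAbs ^ p.natAbs := by
    refine le_trans ?_ (Nat.pow_le_pow_left hpq p.natAbs)
    generalize p.natAbs = P at hP
    have hP' : (0 : ℝ) < P := by exact_mod_cast hP
    have hb := one_add_mul_le_pow (a := 1 / (P : ℝ)) (by linarith [one_div_pos.2 hP']) P
    rw [mul_one_div_cancel hP'.ne', one_add_one_eq_two] at hb
    have hm := mul_le_mul_of_nonneg_right hb (pow_nonneg hP'.le P)
    rw [← mul_pow, add_mul, one_mul, one_div_mul_cancel hP'.ne'] at hm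
    exact_mod_cast hm
  have hlt : n * p.natAbs ^ N < q.natAbs ^ N := by
    rw [hN, mul_comm n p.natAbs, pow_mul, pow_mul]
    calc n * (p.natAbs ^ p.natAbs) ^ n < 2 ^ n * (p.natAbs ^ p.natAbs) ^ n :=
          Nat.mul_lt_mul_of_pos_right Nat.lt_two_pow_self (by positivity)
      _ = (2 * p.natAbs ^ p.natAbs) ^ n := (mul_pow _ _ _).symm
      _ ≤ _ := Nat.pow_le_pow_left h2 n
  have hjj : (j : ℤ) = j' := by
    by_contra hne
    have heq : ((i : ℤ) - i') * p ^ N = (j' - j) * q ^ N := by linarith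
    have habs := congrArg Int.natAbs heq
    rw [Int.natAbs_mul, Int.natAbs_mul, Int.natAbs_pow, Int.natAbs_pow] at habs
    have h1 : 1 ≤ ((j' : ℤ) - j).natAbs := by omega
    have h3 : ((i : ℤ) - i').natAbs ≤ n := by omega
    have := Nat.mul_le_mul_right (q.natAbs ^ N) h1
    have := Nat.mul_le_mul_right (p.natAbs ^ N) h3
    omega
  rw [hjj, add_left_inj] at h
  have := mul_right_cancel₀ (pow_ne_zero N hp) h
  omega

/-- If conjugation by `g` stretches `a` on an `A`-orbit by a rational factor of modulus greater
than `1`, the growth is at least quadratic. -/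
theorem natAbs_le_of_conj_zpow_smul_eq {S : Set G}
    (hfin : S.Finite) (hgen : Subgroup.closure S = ⊤)
    (hgr : ¬ GrowthLE (fun n => n ^ 2) (actionGrowth S X))
    (hA : ∀ a ∈ A, ∀ b ∈ A, Commute a b) {g d : G} {x : X}
    (hd : d ∈ A) (hgx : g⁻¹ • x = d • x) {a : G} (ha : a ∈ A)
    (hax : ∀ r : ℕ, 0 < r → a ^ r • x ≠ x) {p q : ℤ} (hp : p ≠ 0)
    (h : (g * a * g⁻¹) ^ p • x = a ^ q • x) : q.natAbs ≤ p.natAbs := by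
  by_contra! hlt
  obtain ⟨la, hla⟩ := DisplacementLE.exists_of_closure_eq_top X hgen a
  obtain ⟨lg, hlg⟩ := DisplacementLE.exists_of_closure_eq_top X hgen g
  refine hgr (growthLE_sq_of_forall_injOn hfin (2 * la + 2 * p.natAbs * lg) fun n => ?_)
  -- Linear in `n`, yet large enough that `|q/p| ^ N > n`.
  set N := n * p.natAbs with hN
  refine ⟨x, fun i j => a ^ i * (g ^ N * a ^ j * (g ^ N)⁻¹), fun i hi j hj => ?_, ?_⟩
  · refine ((hla.pow i).mul (((hlg.pow N).mul (hla.pow j)).mul (hlg.pow N).inv)).mono ?_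
    rw [hN]
    nlinarith [Nat.mul_le_mul_right la hi.le, Nat.mul_le_mul_right la hj.le]
  · intro i hi j hj i' hi' j' hj' heq
    have hc : g ^ N * a * (g ^ N)⁻¹ ∈ A := Subgroup.Normal.conj_mem ‹_› a ha _
    -- On the orbit the grid element is `a` to the power `i + j * (q/p) ^ N`; raising to `p ^ N`
    -- clears denominators.
    have hkey : ∀ i j : ℕ, (a ^ i * (g ^ N * a ^ j * (g ^ N)⁻¹)) ^ (p ^ N) • x =
        a ^ ((i : ℤ) * p ^ N + j * q ^ N) • x := by
      intro i j
      rw [← conj_pow, ((hA a ha _ hc).pow_pow i j).mul_zpow, mul_smul, ← zpow_natCast _ j,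
        ← zpow_mul, mul_comm (j : ℤ), zpow_mul, zpow_natCast]
      have := (hA _ (A.zpow_mem hc (p ^ N)) _ (A.zpow_mem ha (q ^ N))).zpow_smul_eq_zpow_smul
        (conj_pow_zpow_smul_eq hA hd hgx ha h N) j
      rw [← zpow_natCast _ j, this, ← zpow_natCast a i, ← zpow_mul, ← zpow_mul, ← mul_smul,
        ← zpow_add, mul_comm (q ^ N)]
    have hmem : ∀ i j : ℕ, a ^ i * (g ^ N * a ^ j * (g ^ N)⁻¹) ∈ A := fun i j => by
      rw [← conj_pow]
      exact A.mul_mem (A.pow_mem ha i) (A.pow_mem hc j)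
    have h1 := (hA _ (hmem i j) _ (hmem i' j')).zpow_smul_eq_zpow_smul heq (p ^ N)
    rw [hkey, hkey] at h1
    exact Int.eq_and_eq_of_add_mul_pow_eq hp hlt hi hi' (zpow_smul_injective hax h1)

/-- The square of an element preserving an `A`-orbit acts unipotently on it. -/
theorem exists_pow_commutator_smul_eq {S : Set G}
    (hfin : S.Finite) (hgen : Subgroup.closure S = ⊤)
    (hgr : ¬ GrowthLE (fun n => n ^ 2) (actionGrowth S X))
    (hA : ∀ a ∈ A, ∀ b ∈ A, Commute a b) {g d e : G} {x : X} (hd : d ∈ A)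
    (hgx : g⁻¹ • x = d • x) (he : e ∈ A) (hgx' : g • x = e • x) {a : G} (ha : a ∈ A) :
    ∃ r : ℕ, 0 < r ∧ (g ^ 2 * a * (g ^ 2)⁻¹ * a⁻¹) ^ r • x = x := by
  have hconj : ∀ t : G, t * a * t⁻¹ ∈ A := fun t => Subgroup.Normal.conj_mem ‹_› a ha t
  suffices hs : ∃ k : ℤ, k ≠ 0 ∧ (g ^ 2 * a * (g ^ 2)⁻¹) ^ k • x = a ^ k • x by
    obtain ⟨k, hk, hkx⟩ := hs
    have hz : (g ^ 2 * a * (g ^ 2)⁻¹ * a⁻¹) ^ k ∈ MulAction.stabilizer G x := by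
      rw [MulAction.mem_stabilizer_iff, (hA _ (hconj _) _ (A.inv_mem ha)).mul_zpow,
        (hA _ (A.zpow_mem (hconj _) k) _ (A.zpow_mem (A.inv_mem ha) k)).eq, mul_smul, hkx,
        inv_zpow, inv_smul_smul]
    refine ⟨k.natAbs, Int.natAbs_pos.2 hk, ?_⟩
    rw [← MulAction.mem_stabilizer_iff]
    rcases Int.natAbs_eq k with h | h
    · rwa [h, zpow_natCast] at hz
    · rw [h, zpow_neg, zpow_natCast] at hz
      simpa using Subgroup.inv_mem _ hz
  by_cases htor : ∃ r : ℕ, 0 < r ∧ a ^ r • x = x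
  · obtain ⟨r, hr, hrx⟩ := htor
    refine ⟨r, by exact_mod_cast hr.ne', ?_⟩
    have h1 : ∀ b ∈ A, b • x = (1 : G) • x → (g * b * g⁻¹) • x = (1 : G) • x := fun b hb hbx => by
      simpa using conj_smul_eq_conj_smul hA hd hgx hb A.one_mem hbx
    have hr' : a ^ r • x = (1 : G) • x := by rw [hrx, one_smul]
    have h2 := h1 _ (Subgroup.Normal.conj_mem ‹_› _ (A.pow_mem ha r) g)
      (h1 _ (A.pow_mem ha r) hr')
    have h3 : g * (g * a ^ r * g⁻¹) * g⁻¹ = g ^ 2 * a ^ r * (g ^ 2)⁻¹ := by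
      rw [sq]; group
    rw [h3] at h2
    rw [zpow_natCast, zpow_natCast, conj_pow, h2, hr']
  · push Not at htor
    obtain ⟨p, q, hpq, hx⟩ := exists_zpow_mul_zpow_smul_eq hfin hgen hgr
      (hA _ (hconj g) _ ha) x
    have hx1 : (g * a * g⁻¹) ^ p • x = a ^ (-q) • x := by
      rw [(hA _ (A.zpow_mem (hconj g) p) _ (A.zpow_mem ha q)).eq, mul_smul] at hx
      rw [zpow_neg, eq_inv_smul_iff, hx]
    -- Conjugating back by `g⁻¹` gives the inverse ratio, so the stretching bound applies both ways
    -- and forces `|p| = |q|`. Squaring `g` removes the sign.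
    have hx2 : (g⁻¹ * a * g⁻¹⁻¹) ^ (-q) • x = a ^ p • x := by
      have := conj_smul_eq_conj_smul (g := g⁻¹) hA he (by rwa [inv_inv])
        (A.zpow_mem (hconj g) p) (A.zpow_mem ha (-q)) hx1
      rw [← conj_zpow, ← conj_zpow] at this
      rw [← this]
      congr 2
      group
    have hinj := zpow_smul_injective htor
    have hp : p ≠ 0 := by
      rintro rfl
      rw [zpow_zero] at hx1
      have : (0 : ℤ) = -q := hinj (by simpa using hx1)
      omega
    have hq : -q ≠ 0 := by
      intro hq
      rw [hq, zpow_zero] at hx2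
      exact hp (hinj (by simpa using hx2.symm))
    have hle1 := natAbs_le_of_conj_zpow_smul_eq hfin hgen hgr hA hd hgx ha htor hp hx1
    have hle2 := natAbs_le_of_conj_zpow_smul_eq hfin hgen hgr hA he (by rwa [inv_inv]) ha htor
      hq hx2
    refine ⟨p ^ 2, pow_ne_zero 2 hp, ?_⟩
    rw [conj_pow_zpow_smul_eq hA hd hgx ha hx1 2, (Int.natAbs_eq_iff_sq_eq).1
      (le_antisymm hle2 hle1)]

end AbelianNormal

/-! ### Uniformity over the finitely many orbits -/

section OrbitsOfNormalSubgroup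

variable {G : Type*} [Group G] {X : Type*} [MulAction G X] (A : Subgroup G) [A.Normal]

theorem exists_smul_eq_smul_of_mem_stabilizer_sup {g : G} {x : X}
    (hg : g ∈ MulAction.stabilizer G x ⊔ A) : ∃ e ∈ A, g • x = e • x := by
  obtain ⟨e, he, s, hs, rfl⟩ := Subgroup.mem_sup_of_normal_left.1 (sup_comm _ A ▸ hg)
  exact ⟨e, he, by rw [mul_smul, MulAction.mem_stabilizer_iff.1 hs]⟩

/-- By normality of `A`, the right side is the conjugate by `h` of the subgroup on the left, and the
core lies in every conjugate. -/
theorem normalCore_stabilizer_sup_le (x : X) (h : G) :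
    (MulAction.stabilizer G x ⊔ A).normalCore ≤ MulAction.stabilizer G (h • x) ⊔ A := by
  intro g hg
  have hg' : h⁻¹ * g * h ∈ MulAction.stabilizer G x ⊔ A := by
    simpa using Subgroup.normalCore_le _
      ((Subgroup.normalCore_normal (MulAction.stabilizer G x ⊔ A)).conj_mem g hg h⁻¹)
  obtain ⟨s, hs, c, hc, hsc⟩ := Subgroup.mem_sup_of_normal_right.1 hg'
  have hgc : g = (h * s * h⁻¹) * (h * c * h⁻¹) := by
    calc g = h * (h⁻¹ * g * h) * h⁻¹ := by group
      _ = _ := by rw [← hsc]; group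
  rw [hgc]
  refine Subgroup.mul_mem_sup ?_ (Subgroup.Normal.conj_mem ‹_› c hc h)
  rw [MulAction.mem_stabilizer_iff, mul_smul, inv_smul_smul, mul_smul,
    MulAction.mem_stabilizer_iff.1 hs]

/-- A finite index subgroup preserves every `A`-orbit lying in a `G`-orbit with finitely many
`A`-orbits. -/
theorem exists_normal_finiteIndex_le_stabilizer_sup
    [Finite (MulAction.orbitRel.Quotient G X)] :
    ∃ G₀ : Subgroup G, G₀.Normal ∧ G₀.FiniteIndex ∧
      ∀ x : X, (MulAction.stabilizer G x ⊔ A).FiniteIndex →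
        G₀ ≤ MulAction.stabilizer G x ⊔ A := by
  classical
  let K : MulAction.orbitRel.Quotient G X → Subgroup G := fun q =>
    if (MulAction.stabilizer G q.out ⊔ A).FiniteIndex then
      (MulAction.stabilizer G q.out ⊔ A).normalCore else ⊤
  have hK : ∀ q, (K q).FiniteIndex := by
    intro q
    by_cases h : (MulAction.stabilizer G q.out ⊔ A).FiniteIndex
    · simp only [K, if_pos h]; infer_instance
    · simp only [K, if_neg h]; infer_instance
  have : (⨅ q, K q).FiniteIndex := Subgroup.finiteIndex_iInf hK
  refine ⟨(⨅ q, K q).normalCore, inferInstance, inferInstance, fun x hx => ?_⟩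
  obtain ⟨h, hh⟩ : ∃ h : G,
      h • x = (Quotient.mk (MulAction.orbitRel G X) x : MulAction.orbitRel.Quotient G X).out :=
    MulAction.orbitRel_apply.1 (Quotient.mk_out (s := MulAction.orbitRel G X) x)
  set q : MulAction.orbitRel.Quotient G X := Quotient.mk (MulAction.orbitRel G X) x
  have hq : (MulAction.stabilizer G q.out ⊔ A).FiniteIndex := by
    rw [← hh]
    exact Subgroup.finiteIndex_of_le (normalCore_stabilizer_sup_le A x h)
  refine (Subgroup.normalCore_le _).trans ((iInf_le K q).trans ?_)
  simp only [K, if_pos hq]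
  have hx' : x = h⁻¹ • q.out := by rw [← hh, inv_smul_smul]
  conv_rhs => rw [hx']
  exact normalCore_stabilizer_sup_le A q.out h⁻¹

/-- There are finitely many `G₀`-orbits, each of the relevant ones inside one `A`-orbit, along which
fixing by a power of `b` is constant. The product of the exponents at representatives works. -/
theorem exists_uniform_pow_smul_eq (hA : ∀ a ∈ A, ∀ b ∈ A, Commute a b)
    [Finite (MulAction.orbitRel.Quotient G X)] (G₀ : Subgroup G) [G₀.Normal] [G₀.FiniteIndex]
    {b : G} (hb : b ∈ A)
    (h : ∀ x : X, G₀ ≤ MulAction.stabilizer G x ⊔ A → ∃ r : ℕ, 0 < r ∧ b ^ r • x = x) :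
    ∃ r : ℕ, 0 < r ∧ ∀ x : X, G₀ ≤ MulAction.stabilizer G x ⊔ A → b ^ r • x = x := by
  classical
  have h' : ∀ p : (G ⧸ G₀) × MulAction.orbitRel.Quotient G X, ∃ r : ℕ, 0 < r ∧
      (G₀ ≤ MulAction.stabilizer G (p.1.out • p.2.out) ⊔ A →
        b ^ r • p.1.out • p.2.out = p.1.out • p.2.out) := by
    intro p
    by_cases hp : G₀ ≤ MulAction.stabilizer G (p.1.out • p.2.out) ⊔ A
    · obtain ⟨r, hr, hrp⟩ := h _ hp
      exact ⟨r, hr, fun _ => hrp⟩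
    · exact ⟨1, one_pos, fun hp' => absurd hp' hp⟩
  choose r hr hrp using h'
  have := Fintype.ofFinite ((G ⧸ G₀) × MulAction.orbitRel.Quotient G X)
  refine ⟨∏ p, r p, Finset.prod_pos fun p _ => hr p, fun x hx => ?_⟩
  obtain ⟨g, hg⟩ : ∃ g : G,
      g • (Quotient.mk (MulAction.orbitRel G X) x : MulAction.orbitRel.Quotient G X).out = x :=
    MulAction.orbitRel_apply.1
      ((MulAction.orbitRel G X).symm (Quotient.mk_out (s := MulAction.orbitRel G X) x))
  set q : MulAction.orbitRel.Quotient G X := Quotient.mk (MulAction.orbitRel G X) x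
  obtain ⟨u, hu⟩ := QuotientGroup.mk_out_eq_mul G₀ g
  set t := (g : G ⧸ G₀).out
  have htx : t • q.out = (t * g⁻¹) • x := by rw [mul_smul, ← hg, inv_smul_smul]
  have hmem : t * g⁻¹ ∈ G₀ := by
    rw [hu]
    exact Subgroup.Normal.conj_mem ‹_› _ u.2 g
  obtain ⟨d, hd, hdx⟩ := exists_smul_eq_smul_of_mem_stabilizer_sup A (hx hmem)
  have hfix := hrp ((g : G ⧸ G₀), q) (by
    change G₀ ≤ MulAction.stabilizer G (t • q.out) ⊔ A
    rw [htx]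
    exact (Subgroup.normal_le_normalCore.2 hx).trans (normalCore_stabilizer_sup_le A x _))
  change b ^ _ • t • q.out = t • q.out at hfix
  rw [htx, hdx, ← mul_smul, (hA _ (A.pow_mem hb _) d hd).eq, mul_smul,
    smul_left_cancel_iff] at hfix
  obtain ⟨c, hc⟩ := Finset.dvd_prod_of_mem r (Finset.mem_univ ((g : G ⧸ G₀), q))
  rw [hc, pow_mul]
  exact MulAction.mem_stabilizer_iff.1
    (Subgroup.pow_mem _ (MulAction.mem_stabilizer_iff.2 hfix) c)

end OrbitsOfNormalSubgroup

/-! ### Finite index of the centralizer -/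

/-- `H` is finitely generated, and its quotient by `H ⊓ C` has exponent two; it is therefore abelian
and finite. -/
theorem Subgroup.FiniteIndex.of_sq_mem {G : Type*} [Group G] [Group.FG G] {H C : Subgroup G}
    [H.FiniteIndex] [C.Normal] (h : ∀ g ∈ H, g ^ 2 ∈ C) : C.FiniteIndex := by
  have hsq : ∀ q : H ⧸ C.subgroupOf H, q ^ 2 = 1 := by
    intro q
    induction q using QuotientGroup.induction_on with
    | H g =>
      rw [← QuotientGroup.mk_pow, QuotientGroup.eq_one_iff, Subgroup.mem_subgroupOf]
      exact h g g.2
  let : CommGroup (H ⧸ C.subgroupOf H) :=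
    { (inferInstance : Group (H ⧸ C.subgroupOf H)) with
      mul_comm := fun a b =>
        Commute.of_orderOf_dvd_two (fun g => orderOf_dvd_of_pow_eq_one (hsq g)) a b }
  have hfinite : Finite (H ⧸ C.subgroupOf H) := CommGroup.finite_of_fg_isMulTorsion _ fun q =>
    isOfFinOrder_iff_pow_eq_one.2 ⟨2, two_pos, hsq q⟩
  have hrel : C.relIndex H ≠ 0 := Subgroup.index_ne_zero_of_finite (H := C.subgroupOf H)
  have : (C ⊓ H).FiniteIndex := ⟨by
    rw [← Subgroup.relIndex_mul_index inf_le_right, Subgroup.inf_relIndex_right]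
    exact mul_ne_zero hrel Subgroup.FiniteIndex.index_ne_zero⟩
  exact Subgroup.finiteIndex_of_le (H := C ⊓ H) inf_le_left

theorem finiteIndex_centralizer_of_not_growthLE_sq {G : Type*} [Group G] [Group.FG G]
    (htf : GroupTorsionFree G) {S : Set G} (hfin : S.Finite) (hgen : Subgroup.closure S = ⊤)
    {X : Type*} [MulAction G X] [FaithfulSMul G X]
    [Finite (MulAction.orbitRel.Quotient G X)]
    (hgr : ¬ GrowthLE (fun n => n ^ 2) (actionGrowth S X)) (A : Subgroup G) [A.Normal]
    (hA : ∀ a ∈ A, ∀ b ∈ A, Commute a b) :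
    (Subgroup.centralizer (A : Set G)).FiniteIndex := by
  obtain ⟨G₀, hnormal, hindex, hG₀⟩ := exists_normal_finiteIndex_le_stabilizer_sup (X := X) A
  refine Subgroup.FiniteIndex.of_sq_mem (H := G₀) fun g hg => ?_
  rw [Subgroup.mem_centralizer_iff]
  intro a ha
  have hconj : g ^ 2 * a * (g ^ 2)⁻¹ ∈ A := Subgroup.Normal.conj_mem ‹_› a ha _
  have hb : g ^ 2 * a * (g ^ 2)⁻¹ * a⁻¹ ∈ A := A.mul_mem hconj (A.inv_mem ha)
  suffices h1 : g ^ 2 * a * (g ^ 2)⁻¹ * a⁻¹ = 1 by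
    rw [mul_inv_eq_one, mul_inv_eq_iff_eq_mul] at h1
    exact h1.symm
  obtain ⟨m, hm, hmx⟩ := exists_pow_smul_eq_of_not_growthLE_sq hfin hgen hgr A hb
  obtain ⟨r, hr, hrx⟩ := exists_uniform_pow_smul_eq (X := X) A hA G₀ hb fun x hx => by
    obtain ⟨d, hd, hdx⟩ := exists_smul_eq_smul_of_mem_stabilizer_sup A (hx (G₀.inv_mem hg))
    obtain ⟨e, he, hex⟩ := exists_smul_eq_smul_of_mem_stabilizer_sup A (hx hg)
    exact exists_pow_commutator_smul_eq hfin hgen hgr hA hd hdx he hex ha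
  -- `r` handles the points whose `G`-orbit has finitely many `A`-orbits, `m` the others.
  refine htf.eq_one_of_pow_eq_one (Nat.mul_pos hm hr)
    (FaithfulSMul.eq_of_smul_eq_smul fun x : X => ?_)
  rw [one_smul]
  by_cases hx : (MulAction.stabilizer G x ⊔ A).FiniteIndex
  · rw [mul_comm, pow_mul]
    exact MulAction.mem_stabilizer_iff.1
      (Subgroup.pow_mem _ (MulAction.mem_stabilizer_iff.2 (hrx x (hG₀ x hx))) m)
  · rw [pow_mul]
    exact MulAction.mem_stabilizer_iff.1
      (Subgroup.pow_mem _ (MulAction.mem_stabilizer_iff.2 (hmx x hx)) r)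

/-! ### Self-centralizing abelian normal subgroups and conclusion -/

open scoped commutatorElement in
/-- A solvable group without nonabelian subgroups of nilpotency class two contains a
self-centralizing abelian normal subgroup. -/
theorem exists_normal_centralizer_le {G : Type*} [Group G] [Group.IsSolvable G]
    (h : ∀ u v : G, Commute ⁅u, v⁆ u → Commute ⁅u, v⁆ v → ⁅u, v⁆ = 1) :
    ∃ A : Subgroup G, A.Normal ∧ (∀ a ∈ A, ∀ b ∈ A, Commute a b) ∧
      Subgroup.centralizer (A : Set G) ≤ A := by
  obtain ⟨n, hn⟩ := Group.IsSolvable.solvable (G := G)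
  suffices hs : ∀ k ≤ n, ∃ A : Subgroup G, A.Normal ∧ (∀ a ∈ A, ∀ b ∈ A, Commute a b) ∧
      derivedSeries G k ⊓ Subgroup.centralizer (A : Set G) ≤ A by
    simpa using hs 0 (Nat.zero_le n)
  intro k hk
  -- Climb the derived series from its trivial term, enlarging `A` by the part of each term that
  -- centralizes it.
  induction hk using Nat.decreasingInduction with
  | self =>
    refine ⟨⊥, inferInstance, fun a ha b _ => ?_, by simp [hn]⟩
    rw [Subgroup.mem_bot.1 ha]
    exact Commute.one_left b
  | of_succ k hk ih =>
    obtain ⟨A, hnormal, hA, hle⟩ := ih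
    have := derivedSeries_normal G k
    have hDD : ∀ u ∈ derivedSeries G k ⊓ Subgroup.centralizer (A : Set G),
        ∀ v ∈ derivedSeries G k ⊓ Subgroup.centralizer (A : Set G), Commute u v := by
      intro u hu v hv
      have hu' : u ∈ Subgroup.centralizer (A : Set G) := hu.2
      have hv' : v ∈ Subgroup.centralizer (A : Set G) := hv.2
      -- Being in `A`, the commutator commutes with `u` and `v`, which centralize `A`; the
      -- hypothesis then kills it.
      have hz : ⁅u, v⁆ ∈ A := hle ⟨Subgroup.commutator_mem_commutator hu.1 hv.1, by
        change _ ∈ Subgroup.centralizer (A : Set G)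
        rw [commutatorElement_def]
        exact mul_mem (mul_mem (mul_mem hu' hv') (inv_mem hu')) (inv_mem hv')⟩
      exact commutatorElement_eq_one_iff_commute.1
        (h u v (Subgroup.mem_centralizer_iff.1 hu.2 _ hz)
          (Subgroup.mem_centralizer_iff.1 hv.2 _ hz))
    have hDA : ∀ u ∈ derivedSeries G k ⊓ Subgroup.centralizer (A : Set G),
        ∀ a ∈ A, Commute u a := fun u hu a ha =>
      (Subgroup.mem_centralizer_iff.1 hu.2 a ha).symm
    refine ⟨(derivedSeries G k ⊓ Subgroup.centralizer (A : Set G)) ⊔ A, inferInstance, ?_, ?_⟩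
    · intro x hx y hy
      obtain ⟨u, hu, a, ha, rfl⟩ := Subgroup.mem_sup_of_normal_right.1 hx
      obtain ⟨v, hv, b, hb, rfl⟩ := Subgroup.mem_sup_of_normal_right.1 hy
      exact ((hDD u hu v hv).mul_right (hDA u hu b hb)).mul_left
        ((hDA v hv a ha).symm.mul_right (hA a ha b hb))
    · refine le_trans (inf_le_inf_left _ (Subgroup.centralizer_le ?_)) le_sup_left
      exact_mod_cast (le_sup_right : A ≤ _)

theorem mainTheorem10 (G : Type*) [Group G] [Group.FG G] [Group.IsSolvable G]
    (htf : GroupTorsionFree G) (hva : ¬ IsVirtuallyAbelian G)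
    (S : Set G) (hfin : S.Finite) (hgen : Subgroup.closure S = ⊤)
    (X : Type*) [MulAction G X] [FaithfulSMul G X]
    [Finite (MulAction.orbitRel.Quotient G X)] :
    GrowthLE (fun n => n ^ 2) (actionGrowth S X) := by
  by_contra hgr
  obtain ⟨A, hnormal, hA, hle⟩ := exists_normal_centralizer_le (G := G) fun u v hu hv => by
    by_contra hz
    refine hgr (growthLE_sq_of_commutator_commute htf hfin hgen ?_ hu hv hz)
    rw [commutatorElement_def]
    group
  have := finiteIndex_centralizer_of_not_growthLE_sq htf hfin hgen hgr A hA
  exact hva ⟨A, ⟨⟨fun a b => Subtype.ext (hA a a.2 b b.2)⟩⟩, Subgroup.finiteIndex_of_le hle⟩
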